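/- Let $p$ be a prime number, let $G$ be a $p$-adic analytic group (i.e. a $p$-adic Lie group: a group which is a finite-dimensional analytic manifold over $\mathbb{Q}_p$ with analytic multiplication and inversion; $G$ is not assumed to be compact), and let $k$ be a field of positive characteristic, not necessarily equal to $p$. Let $\mathrm{Rep}_k(G)$ be the category of all $k$-linear representations of $G$, and let $\mathrm{Rep}_k^{\mathrm{sm}}(G)$ be its full subcategory of smooth representations, that is, of those representations $V$ for which the action map $G\times V\to V$ is continuous when $V$ carries the discrete topology. Then for all smooth representations $V, W\in \mathrm{Rep}_k^{\mathrm{sm}}(G)$ one has $$\mathrm{Ext}^1_{\mathrm{Rep}_k^{\mathrm{sm}}(G)}(V,W) = \mathrm{Ext}^1_{\mathrm{Rep}_k(G)}(V,W),$$ in the sense that the canonical $k$-linear map from the left-hand side to the right-hand side induced by the exact inclusion functor $\mathrm{Rep}_k^{\mathrm{sm}}(G)\hookrightarrow \mathrm{Rep}_k(G)$ is an isomorphism. -/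

import Mathlib

open CategoryTheory CategoryTheory.Limits
open scoped Manifold ContDiff

universe w₁ w₂ w v u

/-- A representation `V` of a topological group `G` is smooth if the action map `G × V → V` is
continuous when `V` carries the discrete topology. -/
def smoothProperty (k : Type u) (G : Type v) [Field k] [Group G] [TopologicalSpace G] :
    ObjectProperty (Rep.{w} k G) :=
  fun V => letI : TopologicalSpace V := ⊥; Continuous fun x : G × V => V.ρ x.1 x.2

/-- The category of smooth representations of `G` over `k`, as a full subcategory of the category
of all representations. -/
abbrev SmoothRep (k : Type u) (G : Type v) [Field k] [Group G] [TopologicalSpace G] :=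
  (smoothProperty.{w} k G).FullSubcategory

section

variable {k : Type u} {G : Type v} [Field k] [Group G] [TopologicalSpace G]

/-- Smoothness, rephrased: all orbit maps are locally constant. -/
lemma smoothProperty_iff (V : Rep.{w} k G) :
    smoothProperty k G V ↔ ∀ x : V, IsLocallyConstant fun g : G => V.ρ g x := by
  let _ : TopologicalSpace V := ⊥
  have : DiscreteTopology V := ⟨rfl⟩
  change (Continuous fun x : G × V => V.ρ x.1 x.2) ↔ _
  rw [continuous_prod_of_discrete_right]
  exact forall_congr' fun x => (IsLocallyConstant.iff_continuous _).symm

instance : (smoothProperty.{w} k G).IsClosedUnderSubobjects where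
  prop_of_mono {X Y} f _ hY := by
    rw [smoothProperty_iff] at hY ⊢
    intro x
    have hf := (Rep.mono_iff_injective f).1 inferInstance
    refine IsLocallyConstant.desc (fun g => X.ρ g x) f.hom ?_ hf
    have : (f.hom ∘ fun g => X.ρ g x) = fun g => Y.ρ g (f.hom x) :=
      funext fun g => Rep.hom_comm_apply f g x
    rw [this]
    exact hY _

instance : (smoothProperty.{w} k G).IsClosedUnderQuotients where
  prop_of_epi {X Y} f _ hX := by
    rw [smoothProperty_iff] at hX ⊢
    intro y
    obtain ⟨x, rfl⟩ := (Rep.epi_iff_surjective f).1 inferInstance y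
    have : (fun g => Y.ρ g (f.hom x)) = f.hom ∘ fun g => X.ρ g x :=
      funext fun g => (Rep.hom_comm_apply f g x).symm
    rw [this]
    exact (hX x).comp _

instance : (smoothProperty.{w} k G).ContainsZero where
  exists_zero := by
    obtain ⟨Z, hZ⟩ := HasZeroObject.zero (C := Rep.{w} k G)
    refine ⟨Z, hZ, ?_⟩
    have := (Rep.isZero_iff k G Z).1 hZ
    rw [smoothProperty_iff]
    exact fun x => IsLocallyConstant.iff_exists_open _ |>.2 fun g =>
      ⟨Set.univ, isOpen_univ, trivial, fun _ _ => Subsingleton.elim _ _⟩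

instance : (smoothProperty.{w} k G).IsClosedUnderBinaryProducts where
  limitsOfShape_le := by
    rintro X ⟨p⟩
    let F := p.diag
    let A := F.obj ⟨WalkingPair.left⟩
    let B := F.obj ⟨WalkingPair.right⟩
    have hA : smoothProperty k G A := p.prop_diag_obj _
    have hB : smoothProperty k G B := p.prop_diag_obj _
    let p1 : X ⟶ A := p.π.app ⟨WalkingPair.left⟩
    let p2 : X ⟶ B := p.π.app ⟨WalkingPair.right⟩
    let c : Cone F := ⟨A ⊞ B, {
      app := fun j => match j with
        | ⟨WalkingPair.left⟩ => biprod.fst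
        | ⟨WalkingPair.right⟩ => biprod.snd
      naturality := by
        rintro ⟨i⟩ ⟨j⟩ ⟨⟨h⟩⟩
        obtain rfl : i = j := h
        simp [Discrete.functor_map_id] }⟩
    let s : A ⊞ B ⟶ X := p.isLimit.lift c
    have hs1 : s ≫ p1 = biprod.fst := p.isLimit.fac c ⟨WalkingPair.left⟩
    have hs2 : s ≫ p2 = biprod.snd := p.isLimit.fac c ⟨WalkingPair.right⟩
    have hid : p1 ≫ biprod.inl ≫ s + p2 ≫ biprod.inr ≫ s = 𝟙 X := by
      refine p.isLimit.hom_ext ?_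
      rintro ⟨_ | _⟩
      · change (_ + _) ≫ p1 = _ ≫ p1
        simp [hs1]
      · change (_ + _) ≫ p2 = _ ≫ p2
        simp [hs2]
    rw [smoothProperty_iff] at hA hB ⊢
    intro x
    let i1 : A ⟶ X := biprod.inl ≫ s
    let i2 : B ⟶ X := biprod.inr ≫ s
    have key : ∀ y : X, i1.hom (p1.hom y) + i2.hom (p2.hom y) = y := fun y => by
      have := congrArg (fun f : X ⟶ X => f.hom y) hid
      simpa [i1, i2, Rep.add_hom] using this
    have : (fun g => X.ρ g x) =
        (fun g => i1.hom (A.ρ g (p1.hom x))) + fun g => i2.hom (B.ρ g (p2.hom x)) := by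
      funext g
      rw [Pi.add_apply, ← Rep.hom_comm_apply, ← Rep.hom_comm_apply, key]
    rw [this]
    exact ((hA _).comp i1.hom).add ((hB _).comp i2.hom)

instance : (smoothProperty.{w} k G).IsClosedUnderFiniteProducts :=
  ObjectProperty.IsClosedUnderFiniteProducts.mk'

instance : PreservesFiniteLimits (smoothProperty.{w} k G).ι :=
  haveI := (smoothProperty.{w} k G).preservesKernels_ι
  Functor.preservesFiniteLimits_of_preservesKernels _

instance : PreservesFiniteColimits (smoothProperty.{w} k G).ι :=
  haveI := (smoothProperty.{w} k G).preservesCokernels_ι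
  Functor.preservesFiniteColimits_of_preservesCokernels _

end

/-!
A class in `Ext¹` is a short exact sequence, so it suffices to see that smooth representations are
closed under extensions. For `x` in an extension, the vectors `a • x - x` with `a` close to `1` lie
in the smooth subrepresentation. On a small procyclic subgroup the cocycle `a ↦ a • x - x` is
therefore a homomorphism, and it kills `ℓ`-th powers since `k` has characteristic `ℓ`. Hence the
stabilizer of `x` contains a nontrivial piece of every small procyclic subgroup. Products of `d`
such pieces fill a neighbourhood of `1`: in a chart where the multiplication is the addition up to
the factor `p⁻²`, every small point is reached by successive approximation.
-/

section

open Abelian DerivedCategory Pretriangulated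

attribute [local instance] HasDerivedCategory.standard

variable {C : Type u} [Category.{v} C] [Abelian C]

lemma eq_zero_of_singleFunctor_hom_shift {X Y : C} {n : ℤ}
    (f : (singleFunctor C 0).obj X ⟶ ((singleFunctor C 0).obj Y)⟦n⟧) (hn : n < 0) : f = 0 :=
  have : TStructure.t.IsGE (((singleFunctor C 0).obj Y)⟦n⟧) (-n) :=
    TStructure.t.isGE_shift _ 0 n (-n)
  TStructure.t.zero f 0 (-n)

lemma shortExact_of_singleFunctor_distTriang (S : ShortComplex C)
    {δ : (singleFunctor C 0).obj S.X₃ ⟶ ((singleFunctor C 0).obj S.X₁)⟦(1 : ℤ)⟧}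
    (hT : Triangle.mk ((singleFunctor C 0).map S.f) ((singleFunctor C 0).map S.g) δ ∈
      distTriang (DerivedCategory C)) : S.ShortExact := by
  have hker := Triangulated.AbelianSubcategory.isLimitKernelForkOfDistTriang
    (fun _ _ _ f hn => eq_zero_of_singleFunctor_hom_shift f hn) S.f S.g δ hT
  have hcoker := Triangulated.AbelianSubcategory.isColimitCokernelCoforkOfDistTriang
    (fun _ _ _ f hn => eq_zero_of_singleFunctor_hom_shift f hn) S.f S.g δ hT
  exact
    { exact := S.exact_of_f_is_kernel hker
      mono_f := Fork.IsLimit.mono hker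
      epi_g := Cofork.IsColimit.epi hcoker }

lemma singleδ_eq_of_distTriang {S : ShortComplex C} (hS : S.ShortExact)
    {δ : (singleFunctor C 0).obj S.X₃ ⟶ ((singleFunctor C 0).obj S.X₁)⟦(1 : ℤ)⟧}
    (hT : Triangle.mk ((singleFunctor C 0).map S.f) ((singleFunctor C 0).map S.g) δ ∈
      distTriang (DerivedCategory C)) : hS.singleδ = δ := by
  obtain ⟨c, hc₁, hc₂⟩ := complete_distinguished_triangle_morphism _ _
    hS.singleTriangle_distinguished hT (𝟙 _) (𝟙 _)
    ((Category.comp_id _).trans (Category.id_comp _).symm)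
  obtain ⟨c, rfl⟩ := (singleFunctor C 0).map_surjective c
  have hc : c = 𝟙 S.X₃ := by
    have := hS.epi_g
    rw [← cancel_epi S.g, Category.comp_id]
    apply (singleFunctor C 0).map_injective
    exact (Functor.map_comp _ _ _).trans (hc₁.trans (Category.id_comp _))
  calc hS.singleδ
    _ = hS.singleδ ≫ (𝟙 ((singleFunctor C 0).obj S.X₁))⟦(1 : ℤ)⟧' := by simp
    _ = (singleFunctor C 0).map c ≫ δ := hc₂
    _ = δ := by simp [hc]

lemma exists_singleFunctor_distTriang {X Y : C}
    (δ : (singleFunctor C 0).obj X ⟶ ((singleFunctor C 0).obj Y)⟦(1 : ℤ)⟧) :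
    ∃ (E : C) (f : Y ⟶ E) (g : E ⟶ X),
      Triangle.mk ((singleFunctor C 0).map f) ((singleFunctor C 0).map g) δ ∈
        distTriang (DerivedCategory C) := by
  obtain ⟨Z, f, g, hT⟩ := distinguished_cocone_triangle₂ (C := DerivedCategory C) δ
  have hle : Z.IsLE 0 := TStructure.t.isLE₂ _ hT 0
    (inferInstanceAs (((singleFunctor C 0).obj Y).IsLE 0))
    (inferInstanceAs (((singleFunctor C 0).obj X).IsLE 0))
  have hge : Z.IsGE 0 := TStructure.t.isGE₂ _ hT 0
    (inferInstanceAs (((singleFunctor C 0).obj Y).IsGE 0))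
    (inferInstanceAs (((singleFunctor C 0).obj X).IsGE 0))
  obtain ⟨E, ⟨i⟩⟩ := exists_iso_singleFunctor_obj_of_isGE_of_isLE Z 0
  obtain ⟨f', hf'⟩ := (singleFunctor C 0).map_surjective (f ≫ i.hom)
  obtain ⟨g', hg'⟩ := (singleFunctor C 0).map_surjective (i.inv ≫ g)
  refine ⟨E, f', g', isomorphic_distinguished _ hT _
    (Triangle.isoMk _ _ (Iso.refl _) i.symm (Iso.refl _) ?_ ?_ ?_)⟩
  · change (singleFunctor C 0).map f' ≫ i.inv = 𝟙 _ ≫ f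
    simp [hf']
  · change (singleFunctor C 0).map g' ≫ 𝟙 _ = i.inv ≫ g
    simp [hg']
  · change δ ≫ (𝟙 ((singleFunctor C 0).obj Y))⟦(1 : ℤ)⟧' = 𝟙 _ ≫ δ
    simp

lemma exists_extClass_eq [HasExt.{w} C] {X Y : C} (e : Ext X Y 1) :
    ∃ (E : C) (f : Y ⟶ E) (g : E ⟶ X) (w : f ≫ g = 0)
      (h : (ShortComplex.mk f g w).ShortExact), h.extClass = e := by
  obtain ⟨E, f, g, hT⟩ := exists_singleFunctor_distTriang e.hom
  have w : f ≫ g = 0 := (singleFunctor C 0).map_injective <| by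
    rw [Functor.map_comp, Functor.map_zero]
    exact comp_distTriang_mor_zero₁₂ _ hT
  have h := shortExact_of_singleFunctor_distTriang (.mk f g w) hT
  refine ⟨E, f, g, w, h, ?_⟩
  ext
  rw [h.extClass_hom, singleδ_eq_of_distTriang h hT]

lemma extClass_eq_zero_iff [HasExt.{w} C] {S : ShortComplex C} (hS : S.ShortExact) :
    hS.extClass = 0 ↔ ∃ s : S.X₃ ⟶ S.X₂, s ≫ S.g = 𝟙 S.X₃ := by
  constructor
  · intro h₀
    obtain ⟨s, hs⟩ := Ext.covariant_sequence_exact₃ S.X₃ hS (Ext.mk₀ (𝟙 S.X₃)) (zero_add 1) <| by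
      rw [h₀, Ext.comp_zero]
    obtain ⟨s, rfl⟩ := (Ext.mk₀_bijective _ _).2 s
    exact ⟨s, (Ext.mk₀_bijective _ _).1 ((Ext.mk₀_comp_mk₀ _ _).symm.trans hs)⟩
  · rintro ⟨s, hs⟩
    calc hS.extClass
      _ = (Ext.mk₀ (s ≫ S.g)).comp hS.extClass (zero_add 1) := by rw [hs, Ext.mk₀_id_comp]
      _ = (Ext.mk₀ s).comp ((Ext.mk₀ S.g).comp hS.extClass (zero_add 1)) (zero_add 1) :=
        (Ext.mk₀_comp_mk₀_assoc s S.g hS.extClass).symm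
      _ = 0 := by rw [hS.comp_extClass, Ext.comp_zero]

lemma mapExactFunctor_one_injective [HasExt.{w₁} C] {D : Type*} [Category D] [Abelian D]
    [HasExt.{w₂} D] (F : C ⥤ D) [F.Additive] [PreservesFiniteLimits F] [PreservesFiniteColimits F]
    [F.Full] [F.Faithful] (X Y : C) :
    Function.Injective (Ext.mapExactFunctor F : Ext.{w₁} X Y 1 → _) := by
  refine (injective_iff_map_eq_zero (F.mapExtAddHom X Y 1)).2 fun e he => ?_
  obtain ⟨E, f, g, w, h, rfl⟩ := exists_extClass_eq e
  replace he : (h.map_of_exact F).extClass = 0 := (Ext.mapExactFunctor_extClass F h).symm.trans he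
  obtain ⟨s, hs⟩ := (extClass_eq_zero_iff (h.map_of_exact F)).1 he
  obtain ⟨s, rfl⟩ := F.map_surjective s
  refine (extClass_eq_zero_iff h).2 ⟨s, F.map_injective ?_⟩
  exact (F.map_comp s g).trans (hs.trans (F.map_id X).symm)

lemma mapExactFunctor_one_surjective [HasExt.{w₂} C] (P : ObjectProperty C)
    [P.IsClosedUnderSubobjects] [P.IsClosedUnderQuotients] [P.ContainsZero]
    [P.IsClosedUnderFiniteProducts] [PreservesFiniteLimits P.ι] [PreservesFiniteColimits P.ι]
    [P.IsClosedUnderExtensions] [HasExt.{w₁} P.FullSubcategory] (X Y : P.FullSubcategory) :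
    Function.Surjective (Ext.mapExactFunctor P.ι : Ext.{w₁} X Y 1 → _) := by
  intro e
  obtain ⟨E, f, g, w, h, rfl⟩ := exists_extClass_eq e
  let E' : P.FullSubcategory := ⟨E, P.prop_X₂_of_shortExact h Y.property X.property⟩
  let S : ShortComplex P.FullSubcategory :=
    ShortComplex.mk (P.homMk f : Y ⟶ E') (P.homMk g : E' ⟶ X) (P.ι.map_injective w)
  have hS : S.ShortExact :=
    { exact := (ShortComplex.exact_map_iff_of_faithful S P.ι).1 h.exact
      mono_f := P.ι.mono_of_mono_map h.mono_f
      epi_g := P.ι.epi_of_epi_map h.epi_g }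
  exact ⟨hS.extClass, Ext.mapExactFunctor_extClass _ hS⟩

end

section

variable {𝕜 : Type*} [NontriviallyNormedField 𝕜] {E : Type*} [NormedAddCommGroup E]
  [NormedSpace 𝕜 E]

lemma hasFDerivAt_eq_fst_add_snd {F : E × E → E} {L : E × E →L[𝕜] E}
    (hF : HasFDerivAt F L (0, 0)) (hl : ∀ᶠ x in nhds 0, F (x, 0) = x)
    (hr : ∀ᶠ y in nhds 0, F (0, y) = y) :
    L = ContinuousLinearMap.fst 𝕜 E E + ContinuousLinearMap.snd 𝕜 E E := by
  have hinl : L.comp (ContinuousLinearMap.inl 𝕜 E E) = ContinuousLinearMap.id 𝕜 E :=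
    (hF.comp (f := fun x => (x, (0 : E))) 0 (hasFDerivAt_prodMk_left 0 0)).unique
      ((hasFDerivAt_id (0 : E)).congr_of_eventuallyEq hl)
  have hinr : L.comp (ContinuousLinearMap.inr 𝕜 E E) = ContinuousLinearMap.id 𝕜 E :=
    (hF.comp (f := fun y => ((0 : E), y)) 0 (hasFDerivAt_prodMk_right 0 0)).unique
      ((hasFDerivAt_id (0 : E)).congr_of_eventuallyEq hr)
  ext z
  · simpa using DFunLike.congr_fun hinl z
  · simpa using DFunLike.congr_fun hinr z

variable {G : Type*} [Group G] [TopologicalSpace G] [ChartedSpace E G]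

variable (𝕜) in
lemma contDiffAt_mul_chart {n : WithTop ℕ∞} [LieGroup 𝓘(𝕜, E) n G] :
    ContDiffAt 𝕜 n (fun z : E × E =>
      chartAt E (1 : G) ((chartAt E (1 : G)).symm z.1 * (chartAt E (1 : G)).symm z.2))
      (chartAt E (1 : G) 1, chartAt E (1 : G) 1) := by
  have h := (contMDiffAt_iff.1
    ((contMDiff_mul 𝓘(𝕜, E) n).contMDiffAt (x := ((1 : G), (1 : G))))).2
  simp only [mfld_simps, Function.comp_def] at h
  simpa using! h

variable (𝕜 G) in
lemma exists_chart_hasStrictFDerivAt_mul [CompleteSpace 𝕜] [CompleteSpace E]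
    [LieGroup 𝓘(𝕜, E) ω G] :
    ∃ ψ : OpenPartialHomeomorph G E, 1 ∈ ψ.source ∧ ψ 1 = 0 ∧
      HasStrictFDerivAt (fun z : E × E => ψ (ψ.symm z.1 * ψ.symm z.2))
        (ContinuousLinearMap.fst 𝕜 E E + ContinuousLinearMap.snd 𝕜 E E) (0, 0) := by
  let φ : OpenPartialHomeomorph G E := chartAt E 1
  let ψ := φ.transHomeomorph (Homeomorph.addRight (-φ 1))
  have h1 : (1 : G) ∈ ψ.source := mem_chart_source E 1
  have hψ1 : ψ 1 = 0 := by simp [ψ]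
  have hsymm : ψ.symm 0 = 1 := by rw [← hψ1, ψ.left_inv h1]
  have htarget : ∀ᶠ z : E in nhds 0, z ∈ ψ.target :=
    ψ.open_target.mem_nhds (hψ1 ▸ ψ.map_source h1)
  have hmul : ContDiffAt 𝕜 ω (fun z : E × E => ψ (ψ.symm z.1 * ψ.symm z.2)) (0, 0) := by
    have htranslate : ContDiffAt 𝕜 ω (fun z : E × E => (z.1 + φ 1, z.2 + φ 1)) (0, 0) := by
      fun_prop
    have h := (ContDiffAt.comp ((0 : E), (0 : E))
      (by simpa using contDiffAt_mul_chart 𝕜 (G := G)) htranslate).sub (contDiffAt_const (c := φ 1))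
    simpa [ψ, Function.comp_def, sub_eq_add_neg, Homeomorph.addRight_symm] using h
  have hstrict := hmul.analyticAt.hasStrictFDerivAt
  refine ⟨ψ, h1, hψ1, ?_⟩
  rwa [hasFDerivAt_eq_fst_add_snd hstrict.hasFDerivAt] at hstrict
  · filter_upwards [htarget] with z hz
    simp [hsymm, ψ.right_inv hz]
  · filter_upwards [htarget] with z hz
    simp [hsymm, ψ.right_inv hz]

end

section

variable {G : Type*} [TopologicalSpace G] {E : Type*} [NormedAddCommGroup E]

/-- The closed ball of radius `r` around the origin of a chart. -/
def coordinateBall (ψ : OpenPartialHomeomorph G E) (r : ℝ) : Set G :=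
  {g | g ∈ ψ.source ∧ ‖ψ g‖ ≤ r}

variable [Group G]

/-- `ψ` is a chart centred at the identity of `G` such that, on the ball of radius `r`, the
multiplication read in `ψ` differs from the addition by a map contracting distances by the
factor `ε`. -/
structure IsAlmostAdditive (ψ : OpenPartialHomeomorph G E) (ε r : ℝ) : Prop where
  radius_pos : 0 < r
  nonneg : 0 ≤ ε
  le_one : ε ≤ 1
  one_mem_source : 1 ∈ ψ.source
  map_one : ψ 1 = 0
  closedBall_subset_target : Metric.closedBall 0 r ⊆ ψ.target
  mul_mem_source : ∀ ⦃x y⦄, x ∈ coordinateBall ψ r → y ∈ coordinateBall ψ r → x * y ∈ ψ.source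
  norm_mul_sub_mul_sub_le : ∀ ⦃x y x' y'⦄, x ∈ coordinateBall ψ r → y ∈ coordinateBall ψ r →
    x' ∈ coordinateBall ψ r → y' ∈ coordinateBall ψ r →
    ‖ψ (x * y) - ψ (x' * y') - ((ψ x - ψ x') + (ψ y - ψ y'))‖ ≤
      ε * max ‖ψ x - ψ x'‖ ‖ψ y - ψ y'‖

lemma exists_isAlmostAdditive (𝕜 : Type*) [NontriviallyNormedField 𝕜] [CompleteSpace 𝕜]
    [NormedSpace 𝕜 E] [CompleteSpace E] [ChartedSpace E G] [LieGroup 𝓘(𝕜, E) ω G] {ε : ℝ}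
    (hε₀ : 0 < ε) (hε₁ : ε ≤ 1) {U : Set G} (hU : U ∈ nhds 1) :
    ∃ (ψ : OpenPartialHomeomorph G E) (r : ℝ),
      IsAlmostAdditive ψ ε r ∧ coordinateBall ψ r ⊆ U := by
  have : IsTopologicalGroup G := topologicalGroup_of_lieGroup 𝓘(𝕜, E) ω
  obtain ⟨ψ, h1, hψ1, hderiv⟩ := exists_chart_hasStrictFDerivAt_mul 𝕜 (E := E) G
  have h0 : (0 : E) ∈ ψ.target := hψ1 ▸ ψ.map_source h1
  have hsymm : ψ.symm 0 = 1 := by rw [← hψ1, ψ.left_inv h1]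
  have hcont : ContinuousAt ψ.symm 0 := ψ.symm.continuousAt h0
  have hcont_mul : ContinuousAt (fun z : E × E => ψ.symm z.1 * ψ.symm z.2) (0, 0) :=
    (hcont.comp_of_eq continuousAt_fst rfl).mul (hcont.comp_of_eq continuousAt_snd rfl)
  have hadd := (hasStrictFDerivAt_iff_isLittleO.1 hderiv).def hε₀
  have hsource : ∀ᶠ z : E × E in nhds (0, 0), ψ.symm z.1 * ψ.symm z.2 ∈ ψ.source :=
    hcont_mul.eventually_mem (ψ.open_source.mem_nhds (by simpa [hsymm] using h1))
  have htarget : ∀ᶠ z in nhds (0 : E), z ∈ ψ.target ∧ ψ.symm z ∈ U :=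
    (ψ.open_target.eventually_mem h0).and (hcont.eventually_mem (by rwa [hsymm]))
  obtain ⟨r₁, hr₁, hadd⟩ := Metric.nhds_basis_closedBall.eventually_iff.1 hadd
  obtain ⟨r₂, hr₂, hsource⟩ := Metric.nhds_basis_closedBall.eventually_iff.1 hsource
  obtain ⟨r₃, hr₃, htarget⟩ := Metric.nhds_basis_closedBall.eventually_iff.1 htarget
  let r := min r₁ (min r₂ r₃)
  obtain ⟨h₁, h₂, h₃⟩ : r ≤ r₁ ∧ r ≤ r₂ ∧ r ≤ r₃ := by simp [r]
  refine ⟨ψ, r, ⟨by positivity, hε₀.le, hε₁, h1, hψ1, fun z hz => ?_, fun x y hx hy => ?_,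
    fun x y x' y' hx hy hx' hy' => ?_⟩, fun x hx => ?_⟩
  · exact (htarget (Metric.closedBall_subset_closedBall h₃ hz)).1
  · have := @hsource (ψ x, ψ y) (by simpa [Prod.dist_eq] using ⟨hx.2.trans h₂, hy.2.trans h₂⟩)
    simpa [ψ.left_inv hx.1, ψ.left_inv hy.1] using this
  · have := @hadd ((ψ x, ψ y), (ψ x', ψ y')) (by
      simpa [Prod.dist_eq] using
        ⟨⟨hx.2.trans h₁, hy.2.trans h₁⟩, hx'.2.trans h₁, hy'.2.trans h₁⟩)
    simpa [ψ.left_inv hx.1, ψ.left_inv hy.1, ψ.left_inv hx'.1, ψ.left_inv hy'.1,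
      Prod.norm_def] using this
  · simpa [ψ.left_inv hx.1] using (@htarget (ψ x) (by simpa using hx.2.trans h₃)).2

end

lemma norm_le_of_norm_sub_le {E : Type*} [SeminormedAddCommGroup E] [IsUltrametricDist E]
    {x y : E} {t : ℝ} (hxy : ‖x - y‖ ≤ t) (hy : ‖y‖ ≤ t) : ‖x‖ ≤ t := by
  simpa using (IsUltrametricDist.norm_add_le_max (x - y) y).trans (max_le hxy hy)

namespace IsAlmostAdditive

section Ultrametric

variable {G : Type*} [Group G] [TopologicalSpace G] {E : Type*} [NormedAddCommGroup E]
  {ψ : OpenPartialHomeomorph G E} {ε r : ℝ}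

lemma one_mem (h : IsAlmostAdditive ψ ε r) : 1 ∈ coordinateBall ψ r :=
  ⟨h.one_mem_source, by simpa [h.map_one] using h.radius_pos.le⟩

variable [IsUltrametricDist E]

lemma norm_mul_sub_mul_le (h : IsAlmostAdditive ψ ε r) {x y x' y' : G}
    (hx : x ∈ coordinateBall ψ r) (hy : y ∈ coordinateBall ψ r)
    (hx' : x' ∈ coordinateBall ψ r) (hy' : y' ∈ coordinateBall ψ r) :
    ‖ψ (x * y) - ψ (x' * y')‖ ≤ max ‖ψ x - ψ x'‖ ‖ψ y - ψ y'‖ :=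
  norm_le_of_norm_sub_le
    ((h.norm_mul_sub_mul_sub_le hx hy hx' hy').trans
      (mul_le_of_le_one_left (le_max_of_le_left (norm_nonneg _)) h.le_one))
    (IsUltrametricDist.norm_add_le_max _ _)

/-- The coordinate ball on which a chart is almost additive, as a submonoid of `G`. -/
def submonoid (h : IsAlmostAdditive ψ ε r) : Submonoid G where
  carrier := coordinateBall ψ r
  one_mem' := h.one_mem
  mul_mem' {x y} hx hy := by
    refine ⟨h.mul_mem_source hx hy, ?_⟩
    have hle : ‖ψ (x * y)‖ ≤ max ‖ψ x‖ ‖ψ y‖ := by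
      simpa [h.map_one] using h.norm_mul_sub_mul_le hx hy h.one_mem h.one_mem
    exact hle.trans (max_le hx.2 hy.2)

variable (h : IsAlmostAdditive ψ ε r)
include h

lemma pow_mem {g : G} (hg : g ∈ coordinateBall ψ r) (k : ℕ) : g ^ k ∈ coordinateBall ψ r :=
  h.submonoid.pow_mem hg k

lemma list_map_prod_mem {ι : Type*} {u : ι → G} (hu : ∀ i, u i ∈ coordinateBall ψ r)
    (l : List ι) : (l.map u).prod ∈ coordinateBall ψ r :=
  h.submonoid.list_prod_mem (List.forall_mem_map.2 fun i _ => hu i)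

lemma norm_list_prod_sub_list_prod_le {ι : Type*} {u v : ι → G}
    (hu : ∀ i, u i ∈ coordinateBall ψ r) (hv : ∀ i, v i ∈ coordinateBall ψ r) {t : ℝ} (ht : 0 ≤ t)
    (huv : ∀ i, ‖ψ (u i) - ψ (v i)‖ ≤ t) (l : List ι) :
    ‖ψ (l.map u).prod - ψ (l.map v).prod‖ ≤ t := by
  induction l with
  | nil => simpa using ht
  | cons i l ih =>
    simp only [List.map_cons, List.prod_cons]
    exact (h.norm_mul_sub_mul_le (hu i) (h.list_map_prod_mem hu l) (hv i)
      (h.list_map_prod_mem hv l)).trans (max_le (huv i) ih)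

lemma norm_list_prod_sub_list_prod_sub_sum_le {ι : Type*} {u v : ι → G}
    (hu : ∀ i, u i ∈ coordinateBall ψ r) (hv : ∀ i, v i ∈ coordinateBall ψ r) {t : ℝ} (ht : 0 ≤ t)
    (huv : ∀ i, ‖ψ (u i) - ψ (v i)‖ ≤ t) (l : List ι) :
    ‖ψ (l.map u).prod - ψ (l.map v).prod - (l.map fun i => ψ (u i) - ψ (v i)).sum‖ ≤ ε * t := by
  induction l with
  | nil => simpa using mul_nonneg h.nonneg ht
  | cons i l ih =>
    simp only [List.map_cons, List.prod_cons, List.sum_cons]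
    refine norm_le_of_norm_sub_le ?_ ih
    have hle := max_le (huv i) (h.norm_list_prod_sub_list_prod_le hu hv ht huv l)
    have hcancel : ∀ a b c s : E, a - (b + s) - (c - s) = a - (b + c) := by intros; abel
    rw [hcancel]
    exact (h.norm_mul_sub_mul_sub_le (hu i) (h.list_map_prod_mem hu l) (hv i)
      (h.list_map_prod_mem hv l)).trans (mul_le_mul_of_nonneg_left hle h.nonneg)

lemma norm_pow_sub_nsmul_le {g : G} (hg : g ∈ coordinateBall ψ r) (k : ℕ) :
    ‖ψ (g ^ k) - k • ψ g‖ ≤ ε * ‖ψ g‖ := by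
  simpa [h.map_one] using h.norm_list_prod_sub_list_prod_sub_sum_le (u := fun _ => g)
    (v := fun _ => 1) (fun _ => hg) (fun _ => h.one_mem) (norm_nonneg (ψ g))
    (by simp [h.map_one]) (List.range k)

end Ultrametric

section Padic

variable {p : ℕ} [Fact p.Prime] {G : Type*} [Group G] [TopologicalSpace G] {E : Type*}
  [NormedAddCommGroup E] [NormedSpace ℚ_[p] E] [IsUltrametricDist E]
  {ψ : OpenPartialHomeomorph G E} {r : ℝ} (h : IsAlmostAdditive ψ ((p : ℝ)⁻¹ ^ 2) r)
include h

lemma norm_pow_sub_smul_le {g : G} (hg : g ∈ coordinateBall ψ r) (m : ℕ) :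
    ‖ψ (g ^ m) - (m : ℚ_[p]) • ψ g‖ ≤ (p : ℝ)⁻¹ * (‖(m : ℚ_[p])‖ * ‖ψ g‖) := by
  have hp : (p : ℝ)⁻¹ ≤ 1 := p.cast_inv_le_one
  induction m using Nat.strong_induction_on with
  | _ m ih =>
    by_cases hm : p ∣ m
    · obtain ⟨n, rfl⟩ := hm
      rcases Nat.eq_zero_or_pos n with rfl | hn
      · simp [h.map_one]
      have ihn := ih n (lt_mul_of_one_lt_left hn (Fact.out : p.Prime).one_lt)
      have hle : ‖ψ (g ^ n)‖ ≤ ‖(n : ℚ_[p])‖ * ‖ψ g‖ :=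
        norm_le_of_norm_sub_le (ihn.trans (mul_le_of_le_one_left (by positivity) hp))
          (norm_smul_le _ _)
      -- The error `p⁻² * ‖ψ (g ^ n)‖` of a `p`-th power is still `p⁻¹` times `‖p • ψ (g ^ n)‖`.
      have hpow : ‖ψ ((g ^ n) ^ p) - (p : ℚ_[p]) • ψ (g ^ n)‖ ≤
          (p : ℝ)⁻¹ * ((p : ℝ)⁻¹ * (‖(n : ℚ_[p])‖ * ‖ψ g‖)) := by
        rw [← mul_assoc, ← sq, Nat.cast_smul_eq_nsmul]
        exact (h.norm_pow_sub_nsmul_le (h.pow_mem hg n) p).trans (by gcongr)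
      have hsmul : ‖(p : ℚ_[p]) • (ψ (g ^ n) - (n : ℚ_[p]) • ψ g)‖ ≤
          (p : ℝ)⁻¹ * ((p : ℝ)⁻¹ * (‖(n : ℚ_[p])‖ * ‖ψ g‖)) := by
        rw [norm_smul, Padic.norm_p]
        gcongr
      calc ‖ψ (g ^ (p * n)) - ((p * n : ℕ) : ℚ_[p]) • ψ g‖
        _ = ‖(ψ ((g ^ n) ^ p) - (p : ℚ_[p]) • ψ (g ^ n)) +
              (p : ℚ_[p]) • (ψ (g ^ n) - (n : ℚ_[p]) • ψ g)‖ := by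
          rw [← pow_mul, mul_comm n p, Nat.cast_mul, mul_smul, smul_sub, sub_add_sub_cancel]
        _ ≤ (p : ℝ)⁻¹ * ((p : ℝ)⁻¹ * (‖(n : ℚ_[p])‖ * ‖ψ g‖)) :=
          (IsUltrametricDist.norm_add_le_max _ _).trans (max_le hpow hsmul)
        _ = (p : ℝ)⁻¹ * (‖((p * n : ℕ) : ℚ_[p])‖ * ‖ψ g‖) := by
          rw [Nat.cast_mul, norm_mul, Padic.norm_p, mul_assoc (p : ℝ)⁻¹]
    · rw [Nat.cast_smul_eq_nsmul, (Padic.norm_natCast_eq_one_iff).2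
        ((Fact.out : p.Prime).coprime_iff_not_dvd.2 hm), one_mul]
      refine (h.norm_pow_sub_nsmul_le hg m).trans ?_
      gcongr
      exact pow_le_of_le_one (by positivity) hp two_ne_zero

lemma norm_pow_le {g : G} (hg : g ∈ coordinateBall ψ r) (m : ℕ) :
    ‖ψ (g ^ m)‖ ≤ ‖(m : ℚ_[p])‖ * ‖ψ g‖ :=
  norm_le_of_norm_sub_le ((h.norm_pow_sub_smul_le hg m).trans
    (mul_le_of_le_one_left (by positivity) p.cast_inv_le_one)) (norm_smul_le _ _)

lemma norm_pow_add_sub_pow_sub_smul_le {g : G} (hg : g ∈ coordinateBall ψ r) {e : E} {t : ℝ}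
    (he : ‖e‖ ≤ t) (hge : ‖ψ g - e‖ ≤ (p : ℝ)⁻¹ * t) (n k : ℕ) :
    ‖ψ (g ^ (n + k)) - ψ (g ^ n) - (k : ℚ_[p]) • e‖ ≤ (p : ℝ)⁻¹ * (‖(k : ℚ_[p])‖ * t) := by
  have hp : (p : ℝ)⁻¹ ≤ 1 := p.cast_inv_le_one
  have hg_le : ‖ψ g‖ ≤ t := norm_le_of_norm_sub_le
    (hge.trans (mul_le_of_le_one_left ((norm_nonneg e).trans he) hp)) he
  have hmul : ‖ψ (g ^ n * g ^ k) - ψ (g ^ n) - ψ (g ^ k)‖ ≤ (p : ℝ)⁻¹ * (‖(k : ℚ_[p])‖ * t) := by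
    calc ‖ψ (g ^ n * g ^ k) - ψ (g ^ n) - ψ (g ^ k)‖
      _ ≤ (p : ℝ)⁻¹ ^ 2 * ‖ψ (g ^ k)‖ := by
        simpa [h.map_one] using h.norm_mul_sub_mul_sub_le (h.pow_mem hg n) (h.pow_mem hg k)
          (h.pow_mem hg n) h.one_mem
      _ ≤ (p : ℝ)⁻¹ * (‖(k : ℚ_[p])‖ * t) := by
        gcongr
        · exact pow_le_of_le_one (by positivity) hp two_ne_zero
        · exact (h.norm_pow_le hg k).trans (by gcongr)
  have hpow : ‖ψ (g ^ k) - (k : ℚ_[p]) • ψ g‖ ≤ (p : ℝ)⁻¹ * (‖(k : ℚ_[p])‖ * t) :=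
    (h.norm_pow_sub_smul_le hg k).trans (by gcongr)
  have hsmul : ‖(k : ℚ_[p]) • (ψ g - e)‖ ≤ (p : ℝ)⁻¹ * (‖(k : ℚ_[p])‖ * t) := by
    rw [norm_smul, mul_left_comm]
    gcongr
  have hsplit : ψ (g ^ (n + k)) - ψ (g ^ n) - (k : ℚ_[p]) • e =
      (ψ (g ^ n * g ^ k) - ψ (g ^ n) - ψ (g ^ k)) + (ψ (g ^ k) - (k : ℚ_[p]) • ψ g) +
        (k : ℚ_[p]) • (ψ g - e) := by
    rw [pow_add, smul_sub]
    abel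
  rw [hsplit]
  exact (IsUltrametricDist.norm_add_le_max _ _).trans (max_le
    ((IsUltrametricDist.norm_add_le_max _ _).trans (max_le hmul hpow)) hsmul)

end Padic

end IsAlmostAdditive

section

variable {G : Type*} [Group G] [TopologicalSpace G] [IsTopologicalGroup G] {g : G}

/-- The closed submonoid topologically generated by `g`. When it is compact it is the procyclic
group generated by `g`; working with submonoids avoids negative powers. -/
def monotheticSubmonoid (g : G) : Submonoid G :=
  (Submonoid.powers g).topologicalClosure

lemma isClosed_monotheticSubmonoid (g : G) : IsClosed (monotheticSubmonoid g : Set G) :=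
  Submonoid.isClosed_topologicalClosure _

lemma pow_mem_monotheticSubmonoid (g : G) (n : ℕ) : g ^ n ∈ monotheticSubmonoid g :=
  Submonoid.le_topologicalClosure _ ⟨n, rfl⟩

lemma monotheticSubmonoid_le {S : Submonoid G} (hS : IsClosed (S : Set G)) (hg : g ∈ S) :
    monotheticSubmonoid g ≤ S :=
  Submonoid.topologicalClosure_minimal _ (Submonoid.powers_le.2 hg) hS

lemma monotheticSubmonoid_pow_le (g : G) (n : ℕ) :
    monotheticSubmonoid (g ^ n) ≤ monotheticSubmonoid g :=
  monotheticSubmonoid_le (isClosed_monotheticSubmonoid g) (pow_mem_monotheticSubmonoid g n)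

lemma monotheticSubmonoid_pow_subset_image_pow [T2Space G]
    (hg : IsCompact (monotheticSubmonoid g : Set G)) (n : ℕ) :
    (monotheticSubmonoid (g ^ n) : Set G) ⊆ (· ^ n) '' (monotheticSubmonoid g : Set G) := by
  refine closure_minimal ?_ (hg.image (continuous_pow n)).isClosed
  rintro _ ⟨k, rfl⟩
  exact ⟨g ^ k, pow_mem_monotheticSubmonoid g k, pow_right_comm g k n⟩

lemma commute_of_mem_monotheticSubmonoid [T2Space G] {b : G} (hb : b ∈ monotheticSubmonoid g) :
    Commute g b :=
  (monotheticSubmonoid_le (S := Submonoid.centralizer {g}) (Set.isClosed_centralizer _)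
    (by simp [Submonoid.mem_centralizer_iff]) hb) g rfl

lemma exists_pow_mem_of_isCompact_monotheticSubmonoid
    (hg : IsCompact (monotheticSubmonoid g : Set G)) {H : Subgroup G} (hH : IsOpen (H : Set G)) :
    ∃ n > 0, g ^ n ∈ H := by
  have := QuotientGroup.discreteTopology hH
  obtain ⟨m, n, hmn, hcoset⟩ := Set.Finite.exists_lt_map_eq_of_forall_mem
    (fun n => Set.mem_image_of_mem (QuotientGroup.mk : G → G ⧸ H)
      (pow_mem_monotheticSubmonoid g n)) (hg.image QuotientGroup.continuous_mk).finite_of_discrete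
  refine ⟨n - m, Nat.sub_pos_of_lt hmn, ?_⟩
  rw [pow_sub g hmn.le, ((Commute.refl g).pow_pow n m).inv_right.eq]
  exact QuotientGroup.eq.1 hcoset

end

lemma exists_norm_natCast_mul_sub_le {p : ℕ} [Fact p.Prime] {a y : ℚ_[p]} (h : ‖y‖ ≤ ‖a‖) :
    ∃ n : ℕ, ‖n * a - y‖ ≤ (p : ℝ)⁻¹ * ‖a‖ := by
  rcases eq_or_ne a 0 with rfl | ha
  · exact ⟨0, by simpa using h⟩
  have hp : (0 : ℝ) < (p : ℝ)⁻¹ := by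
    have := (Fact.out : p.Prime).pos
    positivity
  obtain ⟨x, hx⟩ : ∃ x : ℤ_[p], (x : ℚ_[p]) = y / a :=
    ⟨⟨y / a, by rw [norm_div]; exact div_le_one_of_le₀ h (norm_nonneg a)⟩, rfl⟩
  obtain ⟨n, hn⟩ := PadicInt.denseRange_natCast.exists_dist_lt x hp
  rw [dist_comm, dist_eq_norm, PadicInt.norm_def, PadicInt.coe_sub, PadicInt.coe_natCast, hx] at hn
  refine ⟨n, ?_⟩
  calc ‖n * a - y‖
    _ = ‖(n : ℚ_[p]) - y / a‖ * ‖a‖ := by rw [← norm_mul, sub_mul, div_mul_cancel₀ y ha]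
    _ ≤ (p : ℝ)⁻¹ * ‖a‖ := by gcongr

lemma mem_closure_of_tendsto_map {X Y : Type*} [TopologicalSpace X] [TopologicalSpace Y]
    (ψ : OpenPartialHomeomorph X Y) {x : X} (hx : x ∈ ψ.source) {u : ℕ → X} {P : Set X}
    (hu : ∀ n, u n ∈ ψ.source) (hP : ∀ n, u n ∈ P)
    (hlim : Filter.Tendsto (fun n => ψ (u n)) Filter.atTop (nhds (ψ x))) : x ∈ closure P := by
  have hsymm := (ψ.symm.continuousAt (ψ.map_source hx)).tendsto.comp hlim
  rw [ψ.left_inv hx] at hsymm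
  refine mem_closure_of_tendsto hsymm (Filter.Eventually.of_forall fun n => ?_)
  simpa [ψ.left_inv (hu n)] using hP n

section

variable {p : ℕ} [Fact p.Prime] {d : ℕ} {G : Type*} [Group G] [TopologicalSpace G]
  {ψ : OpenPartialHomeomorph G (Fin d → ℚ_[p])} {r : ℝ}

namespace IsAlmostAdditive

variable (h : IsAlmostAdditive ψ ((p : ℝ)⁻¹ ^ 2) r)
include h

lemma exists_norm_pow_add_sub_pow_sub_single_le {g : G} (hg : g ∈ coordinateBall ψ r) {c : ℚ_[p]}
    {i : Fin d} (hgc : ‖ψ g - Pi.single i c‖ ≤ (p : ℝ)⁻¹ * ‖c‖) (n N : ℕ) {y : ℚ_[p]}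
    (hy : ‖y‖ ≤ (p : ℝ)⁻¹ ^ n * ‖c‖) :
    ∃ b : ℕ, ‖ψ (g ^ (N + b)) - ψ (g ^ N) - Pi.single i y‖ ≤
      (p : ℝ)⁻¹ * ((p : ℝ)⁻¹ ^ n * ‖c‖) := by
  have hnorm : ‖(p : ℚ_[p]) ^ n * c‖ = (p : ℝ)⁻¹ ^ n * ‖c‖ := by
    rw [norm_mul, norm_pow, Padic.norm_p]
  have hsingle : ‖(Pi.single i c : Fin d → ℚ_[p])‖ ≤ ‖c‖ := by rw [Pi.norm_single]
  obtain ⟨m, hm⟩ := exists_norm_natCast_mul_sub_le (hy.trans hnorm.ge)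
  refine ⟨m * p ^ n, norm_le_of_norm_sub_le
    (y := ((m * p ^ n : ℕ) : ℚ_[p]) • Pi.single i c - Pi.single i y) ?_ ?_⟩
  · rw [sub_sub_sub_cancel_right]
    refine (h.norm_pow_add_sub_pow_sub_smul_le hg hsingle hgc N _).trans ?_
    rw [Nat.cast_mul, norm_mul, Nat.cast_pow, norm_pow, Padic.norm_p]
    gcongr
    exact mul_le_of_le_one_left (by positivity) (IsUltrametricDist.norm_natCast_le_one ℚ_[p] m)
  · rw [← Pi.single_smul, ← Pi.single_sub, Pi.norm_single, smul_eq_mul, ← hnorm, Nat.cast_mul,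
      Nat.cast_pow, mul_assoc]
    exact hm

lemma exists_norm_list_prod_pow_sub_le {g : Fin d → G} (hg : ∀ i, g i ∈ coordinateBall ψ r)
    {c : ℚ_[p]} (hgc : ∀ i, ‖ψ (g i) - Pi.single i c‖ ≤ (p : ℝ)⁻¹ * ‖c‖) {y : Fin d → ℚ_[p]}
    (hy : ‖y‖ ≤ ‖c‖) (n : ℕ) :
    ∃ a : Fin d → ℕ, ‖ψ ((List.finRange d).map fun i => g i ^ a i).prod - y‖ ≤
      (p : ℝ)⁻¹ ^ n * ‖c‖ := by
  have hp : (p : ℝ)⁻¹ ≤ 1 := p.cast_inv_le_one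
  induction n with
  | zero => exact ⟨0, by simpa [h.map_one] using hy⟩
  | succ n ih =>
    obtain ⟨a, ha⟩ := ih
    set x := ψ ((List.finRange d).map fun i => g i ^ a i).prod
    set t := (p : ℝ)⁻¹ ^ n * ‖c‖ with ht
    have ht₀ : 0 ≤ t := by positivity
    have hcoord : ∀ i, ‖(y - x) i‖ ≤ t := fun i =>
      (norm_le_pi_norm _ i).trans ((norm_sub_rev y x).trans_le ha)
    choose b hb using fun i =>
      h.exists_norm_pow_add_sub_pow_sub_single_le (hg i) (hgc i) n (a i) (hcoord i)
    refine ⟨fun i => a i + b i, ?_⟩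
    set z := ψ ((List.finRange d).map fun i => g i ^ (a i + b i)).prod
    have hmove : ∀ i, ‖ψ (g i ^ (a i + b i)) - ψ (g i ^ a i)‖ ≤ t := fun i =>
      norm_le_of_norm_sub_le ((hb i).trans (mul_le_of_le_one_left ht₀ hp))
        ((Pi.norm_single _).trans_le (hcoord i))
    have hprod : ‖z - x - ∑ i, (ψ (g i ^ (a i + b i)) - ψ (g i ^ a i))‖ ≤ (p : ℝ)⁻¹ * t := by
      rw [Fin.sum_univ_def]
      refine (h.norm_list_prod_sub_list_prod_sub_sum_le (fun i => h.pow_mem (hg i) _)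
        (fun i => h.pow_mem (hg i) _) ht₀ hmove _).trans ?_
      gcongr
      exact pow_le_of_le_one (by positivity) hp two_ne_zero
    have hsum : ‖∑ i, (ψ (g i ^ (a i + b i)) - ψ (g i ^ a i) - Pi.single i ((y - x) i))‖ ≤
        (p : ℝ)⁻¹ * t :=
      IsUltrametricDist.norm_sum_le_of_forall_le_of_nonneg (by positivity) fun i _ => hb i
    rw [pow_succ', mul_assoc, ← ht]
    refine norm_le_of_norm_sub_le ?_ hsum
    rw [Finset.sum_sub_distrib, Finset.univ_sum_single]
    have hcancel : ∀ s : Fin d → ℚ_[p], z - y - (s - (y - x)) = z - x - s := by intros; abel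
    rw [hcancel]
    exact hprod

lemma mem_closure_range_list_prod_pow {g : Fin d → G} (hg : ∀ i, g i ∈ coordinateBall ψ r)
    {c : ℚ_[p]} (hgc : ∀ i, ‖ψ (g i) - Pi.single i c‖ ≤ (p : ℝ)⁻¹ * ‖c‖) {x : G}
    (hx : x ∈ coordinateBall ψ ‖c‖) :
    x ∈ closure (Set.range fun a : Fin d → ℕ =>
      ((List.finRange d).map fun i => g i ^ a i).prod) := by
  have hp : (p : ℝ)⁻¹ < 1 := inv_lt_one_of_one_lt₀ (by exact_mod_cast (Fact.out : p.Prime).one_lt)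
  choose a ha using h.exists_norm_list_prod_pow_sub_le hg hgc hx.2
  refine mem_closure_of_tendsto_map ψ hx.1
    (fun n => (h.list_map_prod_mem (fun i => h.pow_mem (hg i) (a n i)) _).1)
    (fun n => Set.mem_range_self (a n)) ?_
  refine tendsto_iff_norm_sub_tendsto_zero.2 (squeeze_zero (fun _ => norm_nonneg _) ha ?_)
  simpa using (tendsto_pow_atTop_nhds_zero_of_lt_one (by positivity) hp).mul_const ‖c‖

end IsAlmostAdditive

end

namespace IsAlmostAdditive

section Topology

variable {G : Type*} [Group G] [TopologicalSpace G] {E : Type*} [NormedAddCommGroup E]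
  {ψ : OpenPartialHomeomorph G E} {ε r : ℝ} (h : IsAlmostAdditive ψ ε r)
include h

lemma coordinateBall_mem_nhds {s : ℝ} (hs : 0 < s) : coordinateBall ψ s ∈ nhds 1 := by
  filter_upwards [ψ.open_source.mem_nhds h.one_mem_source,
    (ψ.continuousAt h.one_mem_source).preimage_mem_nhds
      (h.map_one ▸ Metric.closedBall_mem_nhds 0 hs)] with x hx hxs
  exact ⟨hx, by simpa [h.map_one] using hxs⟩

lemma isCompact_coordinateBall [ProperSpace E] : IsCompact (coordinateBall ψ r) := by
  have himage : coordinateBall ψ r = ψ.symm '' Metric.closedBall 0 r := by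
    rw [ψ.symm_image_eq_source_inter_preimage h.closedBall_subset_target]
    ext g
    simp [coordinateBall]
  rw [himage]
  exact (isCompact_closedBall _ _).image_of_continuousOn
    (ψ.symm.continuousOn.mono h.closedBall_subset_target)

variable [ProperSpace E] [IsUltrametricDist E] [IsTopologicalGroup G] [T2Space G] {g : G}

lemma monotheticSubmonoid_le_submonoid (hg : g ∈ coordinateBall ψ r) :
    monotheticSubmonoid g ≤ h.submonoid :=
  monotheticSubmonoid_le h.isCompact_coordinateBall.isClosed hg

lemma isCompact_monotheticSubmonoid (hg : g ∈ coordinateBall ψ r) :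
    IsCompact (monotheticSubmonoid g : Set G) :=
  h.isCompact_coordinateBall.of_isClosed_subset (isClosed_monotheticSubmonoid g)
    (h.monotheticSubmonoid_le_submonoid hg)

end Topology

section PadicTopology

variable {p : ℕ} [Fact p.Prime] {d : ℕ} {G : Type*} [Group G] [TopologicalSpace G]
  {ψ : OpenPartialHomeomorph G (Fin d → ℚ_[p])} {r : ℝ} (h : IsAlmostAdditive ψ ((p : ℝ)⁻¹ ^ 2) r)
  [IsTopologicalGroup G] [T2Space G]
include h

lemma coordinateBall_subset_of_monotheticSubmonoid_le {g : Fin d → G}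
    (hg : ∀ i, g i ∈ coordinateBall ψ r) {c : ℚ_[p]}
    (hgc : ∀ i, ‖ψ (g i) - Pi.single i c‖ ≤ (p : ℝ)⁻¹ * ‖c‖) {S : Submonoid G}
    (hS : ∀ i, monotheticSubmonoid (g i) ≤ S) : coordinateBall ψ ‖c‖ ⊆ S := by
  -- `S` need not be closed, but the products of elements of the compact submonoids are.
  let P : Set G := (fun a : Fin d → G => ((List.finRange d).map a).prod) ''
    Set.univ.pi fun i => monotheticSubmonoid (g i)
  have hP : IsCompact P :=
    (isCompact_univ_pi fun i => h.isCompact_monotheticSubmonoid (hg i)).image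
      (continuous_list_prod _ fun i _ => continuous_apply i)
  have hrange : (Set.range fun a : Fin d → ℕ =>
      ((List.finRange d).map fun i => g i ^ a i).prod) ⊆ P := by
    rintro _ ⟨a, rfl⟩
    exact ⟨fun i => g i ^ a i, fun i _ => pow_mem_monotheticSubmonoid (g i) (a i), rfl⟩
  have hPS : P ⊆ S := by
    rintro _ ⟨a, ha, rfl⟩
    exact S.list_prod_mem (List.forall_mem_map.2 fun i _ => hS i (ha i trivial))
  exact fun x hx =>
    hPS (closure_minimal hrange hP.isClosed (h.mem_closure_range_list_prod_pow hg hgc hx))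

lemma submonoid_mem_nhds_one {S : Submonoid G}
    (hS : ∀ g ∈ coordinateBall ψ r, ∃ m > 0, monotheticSubmonoid (g ^ m) ≤ S) :
    (S : Set G) ∈ nhds 1 := by
  obtain ⟨c, hc₀, hcr⟩ := NormedField.exists_norm_lt ℚ_[p] h.radius_pos
  let g : Fin d → G := fun i => ψ.symm (Pi.single i c)
  have hsingle : ∀ i : Fin d, ‖(Pi.single i c : Fin d → ℚ_[p])‖ = ‖c‖ := fun i => by
    rw [Pi.norm_single]
  have htarget : ∀ i : Fin d, (Pi.single i c : Fin d → ℚ_[p]) ∈ ψ.target := fun i =>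
    h.closedBall_subset_target (by simpa [hsingle] using hcr.le)
  have hψg : ∀ i, ψ (g i) = Pi.single i c := fun i => ψ.right_inv (htarget i)
  have hg : ∀ i, g i ∈ coordinateBall ψ r := fun i =>
    ⟨ψ.map_target (htarget i), by rw [hψg, hsingle]; exact hcr.le⟩
  choose m hm₀ hm using fun i => hS (g i) (hg i)
  let M := ∏ i, m i
  have hM : (M : ℚ_[p]) ≠ 0 := Nat.cast_ne_zero.2 (Finset.prod_pos fun i _ => hm₀ i).ne'
  have hpos : 0 < ‖(M : ℚ_[p]) * c‖ := by
    rw [norm_mul]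
    exact mul_pos (norm_pos_iff.2 hM) hc₀
  refine Filter.mem_of_superset (h.coordinateBall_mem_nhds hpos)
    (h.coordinateBall_subset_of_monotheticSubmonoid_le (g := fun i => g i ^ M)
      (fun i => h.pow_mem (hg i) M) (fun i => ?_) fun i => ?_)
  · rw [← smul_eq_mul, Pi.single_smul, ← hψg, smul_eq_mul, norm_mul, ← hsingle i, ← hψg]
    exact h.norm_pow_sub_smul_le (hg i) M
  · obtain ⟨n, hn⟩ : m i ∣ M := Finset.dvd_prod_of_mem m (Finset.mem_univ i)
    rw [hn, pow_mul]
    exact (monotheticSubmonoid_pow_le _ n).trans (hm i)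

end PadicTopology

end IsAlmostAdditive

section

variable {G : Type*} [Group G] {E : Type*} [AddCommGroup E] [DistribMulAction G E]

lemma pow_smul_eq_add_nsmul {b : G} {x : E} (hb : b • (b • x - x) = b • x - x) (n : ℕ) :
    b ^ n • x = x + n • (b • x - x) := by
  induction n with
  | zero => simp
  | succ n ih => rw [pow_succ', mul_smul, ih, smul_add, smul_comm b n, hb, succ_nsmul]; abel

variable [TopologicalSpace G] [IsTopologicalGroup G]

lemma monotheticSubmonoid_le_stabilizer {g : G} {x : E}
    (hx : IsOpen (MulAction.stabilizer G x : Set G)) (hg : g • x = x) :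
    monotheticSubmonoid g ≤ (MulAction.stabilizer G x).toSubmonoid :=
  monotheticSubmonoid_le (Subgroup.isClosed_of_isOpen _ hx) hg

variable [T2Space G]

lemma exists_forall_smul_smul_sub_eq {g : G} (hg : IsCompact (monotheticSubmonoid g : Set G))
    {x : E} (hx : ∀ a ∈ monotheticSubmonoid g,
      IsOpen (MulAction.stabilizer G (a • x - x) : Set G)) :
    ∃ N > 0, ∀ b ∈ monotheticSubmonoid (g ^ N), b • (b • x - x) = b • x - x := by
  have hg_mem : g ∈ monotheticSubmonoid g := by simpa using pow_mem_monotheticSubmonoid g 1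
  obtain ⟨N, hN, hgN⟩ := exists_pow_mem_of_isCompact_monotheticSubmonoid hg (hx g hg_mem)
  refine ⟨N, hN, fun b hb => ?_⟩
  have hbg : b ∈ monotheticSubmonoid g := monotheticSubmonoid_pow_le g N hb
  have hb_fix : b • (g • x - x) = g • x - x :=
    monotheticSubmonoid_le_stabilizer (hx g hg_mem) hgN hb
  have hg_fix : g • (b • x - x) = b • x - x := by
    rw [smul_sub, smul_smul, (commute_of_mem_monotheticSubmonoid hbg).eq, ← smul_smul,
      sub_eq_sub_iff_sub_eq_sub, ← smul_sub, hb_fix]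
  exact monotheticSubmonoid_le_stabilizer (hx b hbg) hg_fix hbg

lemma exists_monotheticSubmonoid_pow_le_stabilizer {ℓ : ℕ} (hℓ : 0 < ℓ) (hE : ∀ x : E, ℓ • x = 0)
    {g : G} (hg : IsCompact (monotheticSubmonoid g : Set G)) {x : E}
    (hx : ∀ a ∈ monotheticSubmonoid g, IsOpen (MulAction.stabilizer G (a • x - x) : Set G)) :
    ∃ m > 0, monotheticSubmonoid (g ^ m) ≤ (MulAction.stabilizer G x).toSubmonoid := by
  obtain ⟨N, hN, hfix⟩ := exists_forall_smul_smul_sub_eq hg hx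
  have hgN : IsCompact (monotheticSubmonoid (g ^ N) : Set G) :=
    hg.of_isClosed_subset (isClosed_monotheticSubmonoid _) (monotheticSubmonoid_pow_le g N)
  refine ⟨N * ℓ, Nat.mul_pos hN hℓ, fun a ha => ?_⟩
  rw [pow_mul] at ha
  obtain ⟨b, hb, rfl⟩ := monotheticSubmonoid_pow_subset_image_pow hgN ℓ ha
  change b ^ ℓ • x = x
  rw [pow_smul_eq_add_nsmul (hfix b hb), hE, add_zero]

end

section

variable (p : ℕ) [Fact p.Prime] (d : ℕ) {G : Type*} [Group G] [TopologicalSpace G]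
  [ChartedSpace (Fin d → ℚ_[p]) G] [LieGroup 𝓘(ℚ_[p], Fin d → ℚ_[p]) ω G]

include p d in
lemma isOpen_stabilizer_of_isOpen_stabilizer_smul_sub {E : Type*} [AddCommGroup E]
    [DistribMulAction G E] {ℓ : ℕ} (hℓ : 0 < ℓ) (hE : ∀ x : E, ℓ • x = 0) {U : Set G}
    (hU : U ∈ nhds 1) {x : E}
    (hx : ∀ a ∈ U, IsOpen (MulAction.stabilizer G (a • x - x) : Set G)) :
    IsOpen (MulAction.stabilizer G x : Set G) := by
  have : IsTopologicalGroup G := topologicalGroup_of_lieGroup 𝓘(ℚ_[p], Fin d → ℚ_[p]) ω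
  have : T1Space G := ChartedSpace.t1Space (Fin d → ℚ_[p]) G
  have hp : (0 : ℝ) < (p : ℝ)⁻¹ := inv_pos.2 (Nat.cast_pos.2 (Fact.out : p.Prime).pos)
  obtain ⟨ψ, r, h, hrU⟩ := exists_isAlmostAdditive ℚ_[p] (E := Fin d → ℚ_[p])
    (pow_pos hp 2) (pow_le_one₀ hp.le p.cast_inv_le_one) hU
  exact Subgroup.isOpen_of_mem_nhds _ (h.submonoid_mem_nhds_one fun g hg =>
    exists_monotheticSubmonoid_pow_le_stabilizer hℓ hE (h.isCompact_monotheticSubmonoid hg)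
      fun a ha => hx a (hrU (h.monotheticSubmonoid_le_submonoid hg ha)))

end

section

variable {k : Type u} {G : Type v} [Field k] [Group G]

/-- The action of `G` underlying a representation, so that smoothness can be expressed by
`MulAction.stabilizer`. -/
abbrev repAction (V : Rep.{w} k G) : DistribMulAction G V :=
  DistribMulAction.compHom V V.ρ

attribute [local instance] repAction

lemma smoothProperty_iff_isOpen_stabilizer [TopologicalSpace G] [IsTopologicalGroup G]
    (V : Rep.{w} k G) :
    smoothProperty k G V ↔ ∀ x : V, IsOpen (MulAction.stabilizer G x : Set G) := by
  let _ : TopologicalSpace V := ⊥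
  have : DiscreteTopology V := ⟨rfl⟩
  rw [← continuousSMul_iff_stabilizer_isOpen]
  exact ⟨fun h => ⟨h⟩, fun h => h.continuous_smul⟩

lemma exists_hom_apply_eq_of_hom_apply_eq_zero {S : ShortComplex (Rep.{w} k G)} (hS : S.Exact)
    {y : S.X₂} (hy : S.g.hom y = 0) : ∃ z : S.X₁, S.f.hom z = y :=
  (ShortComplex.moduleCat_exact_iff _).1 (hS.map (forget₂ (Rep.{w} k G) (ModuleCat.{w} k))) y hy

lemma stabilizer_le_stabilizer_hom_apply {V W : Rep.{w} k G} (f : V ⟶ W) (z : V) :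
    MulAction.stabilizer G z ≤ MulAction.stabilizer G (f.hom z : W) := fun a ha => by
  change W.ρ a (f.hom z) = f.hom z
  rw [← Rep.hom_comm_apply, show V.ρ a z = z from ha]

lemma smoothProperty_isClosedUnderExtensions (p : ℕ) [Fact p.Prime] (d : ℕ) [TopologicalSpace G]
    [ChartedSpace (Fin d → ℚ_[p]) G] [LieGroup 𝓘(ℚ_[p], Fin d → ℚ_[p]) ω G]
    {ℓ : ℕ} [CharP k ℓ] (hℓ : 0 < ℓ) : (smoothProperty.{w} k G).IsClosedUnderExtensions where
  prop_X₂_of_shortExact {S} hS h₁ h₃ := by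
    have : IsTopologicalGroup G := topologicalGroup_of_lieGroup 𝓘(ℚ_[p], Fin d → ℚ_[p]) ω
    rw [smoothProperty_iff_isOpen_stabilizer] at h₁ h₃ ⊢
    have hchar : ∀ x : S.X₂, ℓ • x = 0 := fun x => by
      rw [← Nat.cast_smul_eq_nsmul k, CharP.cast_eq_zero, zero_smul]
    intro x
    refine isOpen_stabilizer_of_isOpen_stabilizer_smul_sub p d hℓ hchar
      ((h₃ (S.g.hom x)).mem_nhds (one_mem _)) fun a ha => ?_
    have hker : S.g.hom (a • x - x) = 0 := by
      change S.g.hom (S.X₂.ρ a x - x) = 0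
      rw [map_sub, Rep.hom_comm_apply, sub_eq_zero]
      exact ha
    obtain ⟨z, hz⟩ := exists_hom_apply_eq_of_hom_apply_eq_zero hS.exact hker
    rw [← hz]
    exact Subgroup.isOpen_mono (stabilizer_le_stabilizer_hom_apply S.f z) (h₁ z)

end

theorem corollary4p5 (p : ℕ) [Fact p.Prime] (d : ℕ)
    (G : Type v) [Group G] [TopologicalSpace G] [ChartedSpace (Fin d → ℚ_[p]) G]
    [LieGroup 𝓘(ℚ_[p], Fin d → ℚ_[p]) ω G]
    (k : Type u) [Field k] (ℓ : ℕ) [CharP k ℓ] (hℓ : 0 < ℓ)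
    [HasExt.{w₁} (SmoothRep.{w} k G)] [HasExt.{w₂} (Rep.{w} k G)]
    (V W : SmoothRep.{w} k G) :
    Function.Bijective ((smoothProperty.{w} k G).ι.mapExtLinearMap k V W 1) := by
  have := smoothProperty_isClosedUnderExtensions.{w} (G := G) (k := k) p d hℓ
  exact ⟨mapExactFunctor_one_injective _ V W, mapExactFunctor_one_surjective _ V W⟩
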